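/- Let $A\in\mathbb{R}^{n\times n}$, $B\in\mathbb{R}^{n\times m}$, let $Q\in\mathbb{R}^{n\times n}$ and $R\in\mathbb{R}^{m\times m}$ be symmetric positive definite, let $\alpha\ge 0$, and assume that $(A,B)$ is controllable. Let $\mathcal{I}^0\subset\{1,2,\dots\}$ be finite and non-empty, and put $\gamma=\max\mathcal{I}^0$. Let $\lambda(A)\subset\mathbb{C}$ be the set of eigenvalues of $A$, and assume that the maximum $$p=p^*=\max\{\,i\in\mathcal{I}^0 : \lambda^i\neq 1 \text{ for all } \lambda\in\lambda(A) \text{ with } \lambda\neq 1\,\}$$ is taken over a non-empty set. For $i\ge 1$ put $A^{(i)}=A^i$, $B^{(i)}=\sum_{q=0}^{i-1}A^qB$, and define $Q^{(i)},R^{(i)},N^{(i)}$ by $Q^{(1)}=Q$, $R^{(1)}=R$, $N^{(1)}=0$ and, for $i\ge 2$, $Q^{(i)}=Q^{(i-1)}+{A^{(i-1)}}^TQA^{(i-1)}$, $R^{(i)}=R^{(i-1)}+{B^{(i-1)}}^TQB^{(i-1)}+R$, $N^{(i)}=N^{(i-1)}+{A^{(i-1)}}^TQB^{(i-1)}$.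 Given a symmetric positive semidefinite matrix $P$, put $$L^{(i)}=\big(R^{(i)}+{B^{(i)}}^TPB^{(i)}\big)^{-1}\big({A^{(i)}}^TPB^{(i)}+N^{(i)}\big)^T,$$ $$P^{(i)}=Q^{(i)}+{A^{(i)}}^TPA^{(i)}-\big({A^{(i)}}^TPB^{(i)}+N^{(i)}\big)L^{(i)}.$$ Call $P$ a Riccati solution if $P$ is symmetric positive semidefinite and $P=P^{(p)}$ for $p=p^*$. The single-loop self-triggered MPC based on a Riccati solution $P$ controls the process $x(k+1)=Ax(k)+Bu(k)$ as follows: the first sample is taken at time $0$; at each sampling instant $k'$ a minimizer $I(k')\in\mathcal{I}^0$ of $i\mapsto \alpha/i+x(k')^TP^{(i)}x(k')$ over $\mathcal{I}^0$ is chosen, the input $u(k)=-L^{(I(k'))}x(k')$ is applied for $k'\le k<k'+I(k')$, and the next sampling instant is $k'+I(k')$. Suppose that either $\alpha=0$ or the following condition holds: (N) no $\lambda\in\lambda(A)$ with $\lambda\ne1$ has $|\lambda|=1$ and argument (modulo $2\pi$) equal to $\frac{2\pi}{\gamma}r$ for some positive integer $r$. Then: 1. if (N) holds, then $p^*=\gamma$;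 2. if the down-sampled pair $(A^{(p^*)},B^{(p^*)})$ is controllable, then there is exactly one Riccati solution, so that the algorithm is well defined; 3. for every Riccati solution $P$, every initial state $x(0)$ and every choice of the minimizers $I(k')$, the single-loop self-triggered MPC based on $P$ gives $\lim_{k\to\infty}x(k)=0$. -/

import Mathlib

namespace SelfTriggered

open Matrix

variable {n m : ℕ}

/-- Controllability of `(A, B)`: the matrix `[B, AB, …, A^(n-1) B]` has rank `n`. -/
def IsControllable (A : Matrix (Fin n) (Fin n) ℝ) (B : Matrix (Fin n) (Fin m) ℝ) : Prop :=
  (Matrix.of fun (r : Fin n) (c : Fin n × Fin m) => (A ^ (c.1 : ℕ) * B) r c.2).rank = n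

/-- The (complex) eigenvalues of a real square matrix. -/
def eigenvalues (A : Matrix (Fin n) (Fin n) ℝ) : Set ℂ :=
  spectrum ℂ (A.map (fun a : ℝ => (a : ℂ)))

/-- The lifted input matrix `B^(i) = ∑_{q < i} A^q B`. -/
def liftB (A : Matrix (Fin n) (Fin n) ℝ) (B : Matrix (Fin n) (Fin m) ℝ) (i : ℕ) :
    Matrix (Fin n) (Fin m) ℝ :=
  ∑ q ∈ Finset.range i, A ^ q * B

/-- The lifted weight `Q^(i)`; the recursion starts at `Q^(0) = 0`, so that `Q^(1) = Q`. -/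
def liftQ (A Q : Matrix (Fin n) (Fin n) ℝ) : ℕ → Matrix (Fin n) (Fin n) ℝ
  | 0 => 0
  | i + 1 => liftQ A Q i + (A ^ i)ᵀ * Q * A ^ i

/-- The lifted weight `R^(i)`; the recursion starts at `R^(0) = 0`, so that `R^(1) = R`. -/
def liftR (A : Matrix (Fin n) (Fin n) ℝ) (B : Matrix (Fin n) (Fin m) ℝ)
    (Q : Matrix (Fin n) (Fin n) ℝ) (R : Matrix (Fin m) (Fin m) ℝ) : ℕ → Matrix (Fin m) (Fin m) ℝ
  | 0 => 0
  | i + 1 => liftR A B Q R i + (liftB A B i)ᵀ * Q * liftB A B i + R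

/-- The lifted cross weight `N^(i)`; the recursion starts at `N^(0) = 0`, so that `N^(1) = 0`. -/
def liftN (A : Matrix (Fin n) (Fin n) ℝ) (B : Matrix (Fin n) (Fin m) ℝ)
    (Q : Matrix (Fin n) (Fin n) ℝ) : ℕ → Matrix (Fin n) (Fin m) ℝ
  | 0 => 0
  | i + 1 => liftN A B Q i + (A ^ i)ᵀ * Q * liftB A B i

/-- The feedback gain `L^(i)`, computed from the terminal weight `P = P^(p)`. -/
noncomputable def gain (A : Matrix (Fin n) (Fin n) ℝ) (B : Matrix (Fin n) (Fin m) ℝ)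
    (Q : Matrix (Fin n) (Fin n) ℝ) (R : Matrix (Fin m) (Fin m) ℝ)
    (P : Matrix (Fin n) (Fin n) ℝ) (i : ℕ) : Matrix (Fin m) (Fin n) ℝ :=
  (liftR A B Q R i + (liftB A B i)ᵀ * P * liftB A B i)⁻¹ *
    ((A ^ i)ᵀ * P * liftB A B i + liftN A B Q i)ᵀ

/-- The cost matrix `P^(i)`, computed from the terminal weight `P = P^(p)`. -/
noncomputable def costMatrix (A : Matrix (Fin n) (Fin n) ℝ) (B : Matrix (Fin n) (Fin m) ℝ)
    (Q : Matrix (Fin n) (Fin n) ℝ) (R : Matrix (Fin m) (Fin m) ℝ)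
    (P : Matrix (Fin n) (Fin n) ℝ) (i : ℕ) : Matrix (Fin n) (Fin n) ℝ :=
  liftQ A Q i + (A ^ i)ᵀ * P * A ^ i -
    ((A ^ i)ᵀ * P * liftB A B i + liftN A B Q i) * gain A B Q R P i

/-- `P` is a (symmetric) positive semidefinite solution of the algebraic Riccati equation of
period `p`. -/
def IsRiccatiSolution (A : Matrix (Fin n) (Fin n) ℝ) (B : Matrix (Fin n) (Fin m) ℝ)
    (Q : Matrix (Fin n) (Fin n) ℝ) (R : Matrix (Fin m) (Fin m) ℝ) (p : ℕ)
    (P : Matrix (Fin n) (Fin n) ℝ) : Prop :=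
  P.PosSemidef ∧ P = costMatrix A B Q R P p

/-- The optimal predicted cost `α / i + ‖ξ‖²_{P^(i)}` of waiting `i` steps from state `ξ`. -/
noncomputable def waitCost (A : Matrix (Fin n) (Fin n) ℝ) (B : Matrix (Fin n) (Fin m) ℝ)
    (Q : Matrix (Fin n) (Fin n) ℝ) (R : Matrix (Fin m) (Fin m) ℝ) (α : ℝ)
    (P : Matrix (Fin n) (Fin n) ℝ) (ξ : Fin n → ℝ) (i : ℕ) : ℝ :=
  α / (i : ℝ) + ξ ⬝ᵥ (costMatrix A B Q R P i *ᵥ ξ)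

/-- `x, u` are the state and input of the process under the single-loop self-triggered MPC, where
`s j` is the `j`-th sampling instant and `I j` the waiting time chosen there (any minimizer). -/
structure IsClosedLoop (A : Matrix (Fin n) (Fin n) ℝ) (B : Matrix (Fin n) (Fin m) ℝ)
    (Q : Matrix (Fin n) (Fin n) ℝ) (R : Matrix (Fin m) (Fin m) ℝ) (α : ℝ) (I₀ : Finset ℕ)
    (P : Matrix (Fin n) (Fin n) ℝ) (x : ℕ → Fin n → ℝ) (u : ℕ → Fin m → ℝ)
    (s I : ℕ → ℕ) : Prop where
  dynamics : ∀ k, x (k + 1) = A *ᵥ x k + B *ᵥ u k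
  first_sample : s 0 = 0
  next_sample : ∀ j, s (j + 1) = s j + I j
  wait_mem : ∀ j, I j ∈ I₀
  wait_min : ∀ j, ∀ i ∈ I₀,
    waitCost A B Q R α P (x (s j)) (I j) ≤ waitCost A B Q R α P (x (s j)) i
  input : ∀ j k, s j ≤ k → k < s j + I j → u k = -(gain A B Q R P (I j) *ᵥ x (s j))

/-- The rates `i ∈ I₀` such that no eigenvalue `z ≠ 1` of `A` satisfies `z ^ i = 1`. -/
def admissibleRates (A : Matrix (Fin n) (Fin n) ℝ) (I₀ : Finset ℕ) : Set ℕ :=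
  {i | i ∈ I₀ ∧ ∀ z ∈ eigenvalues A, z ≠ 1 → z ^ i ≠ 1}

/-- No eigenvalue of `A`, except possibly `1`, has modulus one and argument (modulo `2π`)
`(2π / γ) * r` for a positive integer `r`. -/
def NoResonance (A : Matrix (Fin n) (Fin n) ℝ) (γ : ℕ) : Prop :=
  ¬ ∃ z ∈ eigenvalues A, z ≠ 1 ∧ ‖z‖ = 1 ∧
    ∃ r : ℕ, 0 < r ∧ (z.arg : Real.Angle) = ((2 * Real.pi / (γ : ℝ) * (r : ℝ) : ℝ) : Real.Angle)

end SelfTriggered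

namespace SelfTriggered

open Matrix Filter Topology

variable {n m : ℕ}

/-! ### Quadratic forms of real matrices -/

/-! The form of `P^(i)` is the optimal cost of holding one input for `i` steps and then paying the
terminal cost `P`; completing the square shows this (`costMatrix_le`, `costMatrix_eq`). A Riccati
solution is thus a fixed point of the `p`-step Bellman operator.

Convergence: `p` is an allowed wait, so the chosen wait `I` satisfies `α / I + ξᵀ P^(I) ξ ≤ α / p +
ξᵀ P ξ`. If `I ≤ γ = p`, or if `α = 0`, then `α / p ≤ α / I`, hence `ξᵀ P^(I) ξ ≤ ξᵀ P ξ`. The form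
of `P` therefore drops between samples by at least the state cost incurred, so `∑ xᵀ Q x` is finite
and `x → 0` (`IsClosedLoop.tendsto_zero`).

Existence: value iteration from `0` is increasing and bounded by the cost of steering to the origin
in `n` periods; its limit is a fixed point. Uniqueness: the feedback of one solution is stabilizing,
and using it as a competitor for another gives the inequality in both directions
(`IsRiccatiSolution.le`).

If (N) holds, no eigenvalue other than `1` is a `γ`-th root of unity, so `γ` is admissible and `p =
γ`. -/

lemma isHermitian_iff_transpose_eq {k : ℕ} {M : Matrix (Fin k) (Fin k) ℝ} :
    M.IsHermitian ↔ Mᵀ = M := by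
  rw [Matrix.IsHermitian, conjTranspose_eq_transpose_of_trivial]

lemma dotProduct_transpose_mul_mul_mulVec {k l r t : ℕ} (X : Matrix (Fin k) (Fin l) ℝ)
    (M : Matrix (Fin k) (Fin r) ℝ) (Y : Matrix (Fin r) (Fin t) ℝ)
    (a : Fin l → ℝ) (b : Fin t → ℝ) :
    a ⬝ᵥ ((Xᵀ * M * Y) *ᵥ b) = (X *ᵥ a) ⬝ᵥ (M *ᵥ (Y *ᵥ b)) := by
  rw [Matrix.mul_assoc, ← mulVec_mulVec, ← mulVec_mulVec, dotProduct_mulVec, vecMul_transpose]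

lemma dotProduct_mulVec_swap {k : ℕ} {M : Matrix (Fin k) (Fin k) ℝ} (hM : Mᵀ = M)
    (a b : Fin k → ℝ) : a ⬝ᵥ (M *ᵥ b) = b ⬝ᵥ (M *ᵥ a) := by
  rw [dotProduct_mulVec, ← mulVec_transpose, hM, dotProduct_comm]

lemma quadForm_add {k : ℕ} {M : Matrix (Fin k) (Fin k) ℝ} (hM : Mᵀ = M) (a b : Fin k → ℝ) :
    (a + b) ⬝ᵥ (M *ᵥ (a + b)) =
      a ⬝ᵥ (M *ᵥ a) + 2 * (a ⬝ᵥ (M *ᵥ b)) + b ⬝ᵥ (M *ᵥ b) := by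
  rw [mulVec_add, dotProduct_add, add_dotProduct, add_dotProduct, dotProduct_mulVec_swap hM b a]
  ring

lemma quadForm_nonneg {k : ℕ} {M : Matrix (Fin k) (Fin k) ℝ} (hM : M.PosSemidef)
    (a : Fin k → ℝ) : 0 ≤ a ⬝ᵥ (M *ᵥ a) := by
  simpa using hM.dotProduct_mulVec_nonneg a

/-- Polarization: it transfers equality and convergence of quadratic forms to matrix entries. -/
lemma apply_eq_quadForm {k : ℕ} {M : Matrix (Fin k) (Fin k) ℝ} (hM : Mᵀ = M) (i j : Fin k) :
    M i j = ((Pi.single i 1 + Pi.single j 1) ⬝ᵥ (M *ᵥ (Pi.single i 1 + Pi.single j 1)) -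
      Pi.single i 1 ⬝ᵥ (M *ᵥ Pi.single i 1) - Pi.single j 1 ⬝ᵥ (M *ᵥ Pi.single j 1)) / 2 := by
  rw [quadForm_add hM]
  simp only [mulVec_single_one, single_dotProduct, one_mul, col_apply]
  ring

lemma eq_of_quadForm_eq {k : ℕ} {M M' : Matrix (Fin k) (Fin k) ℝ} (hM : Mᵀ = M) (hM' : M'ᵀ = M')
    (h : ∀ a, a ⬝ᵥ (M *ᵥ a) = a ⬝ᵥ (M' *ᵥ a)) : M = M' := by
  ext i j
  rw [apply_eq_quadForm hM, apply_eq_quadForm hM', h, h, h]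

/-- Completing the square in the input. -/
lemma quadForm_complete_square {T : Matrix (Fin n) (Fin n) ℝ} {S : Matrix (Fin n) (Fin m) ℝ}
    {M : Matrix (Fin m) (Fin m) ℝ} (hM : M.PosDef) (a : Fin n → ℝ) (b : Fin m → ℝ) :
    a ⬝ᵥ (T *ᵥ a) + 2 * (a ⬝ᵥ (S *ᵥ b)) + b ⬝ᵥ (M *ᵥ b) =
      a ⬝ᵥ ((T - S * (M⁻¹ * Sᵀ)) *ᵥ a) +
        (b + (M⁻¹ * Sᵀ) *ᵥ a) ⬝ᵥ (M *ᵥ (b + (M⁻¹ * Sᵀ) *ᵥ a)) := by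
  have hMt : Mᵀ = M := isHermitian_iff_transpose_eq.1 hM.isHermitian
  have hdet : IsUnit M.det := (Matrix.isUnit_iff_isUnit_det M).1 hM.isUnit
  have hcancel : M *ᵥ ((M⁻¹ * Sᵀ) *ᵥ a) = Sᵀ *ᵥ a := by
    rw [mulVec_mulVec, ← Matrix.mul_assoc, Matrix.mul_nonsing_inv M hdet, Matrix.one_mul]
  have hS : ∀ c, c ⬝ᵥ (Sᵀ *ᵥ a) = a ⬝ᵥ (S *ᵥ c) := fun c => by
    rw [dotProduct_mulVec, vecMul_transpose, dotProduct_comm]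
  rw [quadForm_add hMt, hcancel, hS, hS, sub_mulVec, dotProduct_sub, ← mulVec_mulVec]
  ring

/-- Cauchy–Schwarz for the inner product of `M`: the coordinate `a i` is the product of `a` with `w
= M⁻¹ eᵢ`, and `w i` is the squared norm of `w`. -/
lemma sq_apply_le_quadForm {M : Matrix (Fin n) (Fin n) ℝ} (hM : M.PosDef) (i : Fin n) :
    ∃ c : ℝ, ∀ a : Fin n → ℝ, a i ^ 2 ≤ c * (a ⬝ᵥ (M *ᵥ a)) := by
  have hMt : Mᵀ = M := isHermitian_iff_transpose_eq.1 hM.isHermitian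
  have hdet : IsUnit M.det := (Matrix.isUnit_iff_isUnit_det M).1 hM.isUnit
  set w : Fin n → ℝ := M⁻¹ *ᵥ Pi.single i 1 with hw
  have hMw : M *ᵥ w = Pi.single i 1 := by
    rw [hw, mulVec_mulVec, Matrix.mul_nonsing_inv M hdet, Matrix.one_mulVec]
  have hc : 0 < w i := by
    have hw0 : w ≠ 0 := by
      intro h0
      have := congrFun hMw i
      simp [h0] at this
    have := hM.dotProduct_mulVec_pos hw0
    rw [hMw] at this
    simpa using this
  refine ⟨w i, fun a => ?_⟩
  -- The residual of `a` after projection onto `w`, orthogonally for `M`.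
  have h := quadForm_nonneg hM.posSemidef (a + (-(a i / w i)) • w)
  rw [quadForm_add hMt, mulVec_smul, hMw] at h
  simp only [dotProduct_smul, dotProduct_single, smul_eq_mul, mul_one, Pi.smul_apply] at h
  have ht : a i / w i * w i = a i := div_mul_cancel₀ _ hc.ne'
  generalize a i / w i = t at h ht
  rw [← ht] at h ⊢
  linarith [mul_nonneg hc.le h]

lemma tendsto_zero_of_sum_quadForm_le {M : Matrix (Fin n) (Fin n) ℝ} (hM : M.PosDef)
    {x : ℕ → Fin n → ℝ} {C : ℝ}
    (hC : ∀ N, ∑ k ∈ Finset.range N, x k ⬝ᵥ (M *ᵥ x k) ≤ C) : Tendsto x atTop (𝓝 0) := by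
  have hs : Summable fun k => x k ⬝ᵥ (M *ᵥ x k) :=
    summable_of_sum_range_le (fun k => quadForm_nonneg hM.posSemidef (x k)) hC
  rw [tendsto_pi_nhds]
  intro i
  obtain ⟨c, hc⟩ := sq_apply_le_quadForm hM i
  have h0 : Tendsto (fun k => x k i ^ 2) atTop (𝓝 0) :=
    squeeze_zero (fun k => sq_nonneg _) (fun k => hc (x k))
      (by simpa using hs.tendsto_atTop_zero.const_mul c)
  have h1 := h0.sqrt
  simp only [Real.sqrt_sq_eq_abs, Real.sqrt_zero] at h1
  exact (tendsto_zero_iff_abs_tendsto_zero _).2 h1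

/-! ### Holding a constant input -/

/-- The state reached from `x` by holding the input `v` for `i` steps. -/
def holdState (A : Matrix (Fin n) (Fin n) ℝ) (B : Matrix (Fin n) (Fin m) ℝ)
    (x : Fin n → ℝ) (v : Fin m → ℝ) (i : ℕ) : Fin n → ℝ :=
  A ^ i *ᵥ x + liftB A B i *ᵥ v

/-- The cost of holding the input `v` for `i` steps from the state `x`. -/
def holdCost (A : Matrix (Fin n) (Fin n) ℝ) (B : Matrix (Fin n) (Fin m) ℝ)
    (Q : Matrix (Fin n) (Fin n) ℝ) (R : Matrix (Fin m) (Fin m) ℝ)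
    (x : Fin n → ℝ) (v : Fin m → ℝ) (i : ℕ) : ℝ :=
  ∑ q ∈ Finset.range i,
    (holdState A B x v q ⬝ᵥ (Q *ᵥ holdState A B x v q) + v ⬝ᵥ (R *ᵥ v))

variable {A : Matrix (Fin n) (Fin n) ℝ} {B : Matrix (Fin n) (Fin m) ℝ}
  {Q : Matrix (Fin n) (Fin n) ℝ} {R : Matrix (Fin m) (Fin m) ℝ}
  {P P' : Matrix (Fin n) (Fin n) ℝ}

lemma holdState_zero (x : Fin n → ℝ) (v : Fin m → ℝ) : holdState A B x v 0 = x := by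
  simp [holdState, liftB]

lemma holdState_succ (x : Fin n → ℝ) (v : Fin m → ℝ) (i : ℕ) :
    holdState A B x v (i + 1) = A *ᵥ holdState A B x v i + B *ᵥ v := by
  have hB : liftB A B (i + 1) = A * liftB A B i + B := by
    simp only [liftB, Finset.sum_range_succ', Matrix.mul_sum, pow_zero, Matrix.one_mul, pow_succ',
      Matrix.mul_assoc]
  rw [holdState, holdState, hB, pow_succ', add_mulVec, mulVec_add, mulVec_mulVec, mulVec_mulVec,
    add_assoc]

lemma holdCost_nonneg (hQ : Q.PosSemidef) (hR : R.PosSemidef) (x : Fin n → ℝ) (v : Fin m → ℝ)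
    (i : ℕ) : 0 ≤ holdCost A B Q R x v i :=
  Finset.sum_nonneg fun _ _ => add_nonneg (quadForm_nonneg hQ _) (quadForm_nonneg hR _)

lemma sum_quadForm_holdState_le_holdCost (hR : R.PosSemidef) (x : Fin n → ℝ) (v : Fin m → ℝ)
    (i : ℕ) :
    ∑ q ∈ Finset.range i, holdState A B x v q ⬝ᵥ (Q *ᵥ holdState A B x v q) ≤
      holdCost A B Q R x v i :=
  Finset.sum_le_sum fun _ _ => le_add_of_nonneg_right (quadForm_nonneg hR _)

lemma quadForm_le_holdCost (hQ : Q.PosSemidef) (hR : R.PosSemidef) (x : Fin n → ℝ)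
    (v : Fin m → ℝ) {i : ℕ} (hi : 1 ≤ i) : x ⬝ᵥ (Q *ᵥ x) ≤ holdCost A B Q R x v i := by
  refine le_trans ?_ (sum_quadForm_holdState_le_holdCost hR x v i)
  have := Finset.single_le_sum
    (f := fun q => holdState A B x v q ⬝ᵥ (Q *ᵥ holdState A B x v q))
    (fun q _ => quadForm_nonneg hQ _) (Finset.mem_range.2 hi)
  simpa only [holdState_zero] using this

lemma holdCost_eq (hQ : Qᵀ = Q) (x : Fin n → ℝ) (v : Fin m → ℝ) (i : ℕ) :
    holdCost A B Q R x v i = x ⬝ᵥ (liftQ A Q i *ᵥ x) + 2 * (x ⬝ᵥ (liftN A B Q i *ᵥ v)) +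
      v ⬝ᵥ (liftR A B Q R i *ᵥ v) := by
  induction i with
  | zero => simp [holdCost, liftQ, liftN, liftR]
  | succ i ih =>
    rw [holdCost, Finset.sum_range_succ, ← holdCost, ih, holdState, quadForm_add hQ]
    simp only [liftQ, liftN, liftR, add_mulVec, dotProduct_add,
      dotProduct_transpose_mul_mul_mulVec]
    ring

/-- The total cost splits into its minimum and the deviation from the optimal input. -/
lemma holdCost_add_eq (hQ : Q.PosSemidef) (hP : P.PosSemidef) {i : ℕ}
    (hM : (liftR A B Q R i + (liftB A B i)ᵀ * P * liftB A B i).PosDef)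
    (x : Fin n → ℝ) (v : Fin m → ℝ) :
    holdCost A B Q R x v i + holdState A B x v i ⬝ᵥ (P *ᵥ holdState A B x v i) =
      x ⬝ᵥ (costMatrix A B Q R P i *ᵥ x) +
        (v + gain A B Q R P i *ᵥ x) ⬝ᵥ
          ((liftR A B Q R i + (liftB A B i)ᵀ * P * liftB A B i) *ᵥ
            (v + gain A B Q R P i *ᵥ x)) := by
  have hQt := isHermitian_iff_transpose_eq.1 hQ.isHermitian
  have hPt := isHermitian_iff_transpose_eq.1 hP.isHermitian
  rw [costMatrix, gain, ← quadForm_complete_square hM, holdCost_eq hQt, holdState,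
    quadForm_add hPt]
  simp only [add_mulVec, dotProduct_add, dotProduct_transpose_mul_mul_mulVec]
  ring

lemma liftR_posSemidef (hQ : Q.PosSemidef) (hR : R.PosSemidef) (i : ℕ) :
    (liftR A B Q R i).PosSemidef := by
  induction i with
  | zero => exact PosSemidef.zero
  | succ i ih =>
    have := hQ.conjTranspose_mul_mul_same (liftB A B i)
    rw [conjTranspose_eq_transpose_of_trivial] at this
    exact (ih.add this).add hR

lemma liftR_posDef (hQ : Q.PosSemidef) (hR : R.PosDef) {i : ℕ} (hi : 1 ≤ i) :
    (liftR A B Q R i).PosDef := by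
  obtain ⟨i, rfl⟩ := Nat.exists_eq_add_of_le' hi
  have := hQ.conjTranspose_mul_mul_same (liftB A B i)
  rw [conjTranspose_eq_transpose_of_trivial] at this
  exact PosDef.posSemidef_add ((liftR_posSemidef hQ hR.posSemidef i).add this) hR

lemma gainWeight_posDef (hQ : Q.PosSemidef) (hR : R.PosDef) (hP : P.PosSemidef) {i : ℕ}
    (hi : 1 ≤ i) : (liftR A B Q R i + (liftB A B i)ᵀ * P * liftB A B i).PosDef := by
  have := hP.conjTranspose_mul_mul_same (liftB A B i)
  rw [conjTranspose_eq_transpose_of_trivial] at this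
  exact (liftR_posDef hQ hR hi).add_posSemidef this

lemma costMatrix_le (hQ : Q.PosSemidef) (hR : R.PosDef) (hP : P.PosSemidef) {i : ℕ}
    (hi : 1 ≤ i) (x : Fin n → ℝ) (v : Fin m → ℝ) :
    x ⬝ᵥ (costMatrix A B Q R P i *ᵥ x) ≤
      holdCost A B Q R x v i + holdState A B x v i ⬝ᵥ (P *ᵥ holdState A B x v i) := by
  have hM := gainWeight_posDef (A := A) (B := B) hQ hR hP hi
  rw [holdCost_add_eq hQ hP hM]
  exact le_add_of_nonneg_right (quadForm_nonneg hM.posSemidef _)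

lemma costMatrix_eq (hQ : Q.PosSemidef) (hR : R.PosDef) (hP : P.PosSemidef) {i : ℕ}
    (hi : 1 ≤ i) (x : Fin n → ℝ) :
    x ⬝ᵥ (costMatrix A B Q R P i *ᵥ x) =
      holdCost A B Q R x (-(gain A B Q R P i *ᵥ x)) i +
        holdState A B x (-(gain A B Q R P i *ᵥ x)) i ⬝ᵥ
          (P *ᵥ holdState A B x (-(gain A B Q R P i *ᵥ x)) i) := by
  rw [holdCost_add_eq hQ hP (gainWeight_posDef hQ hR hP hi)]
  simp

lemma liftQ_transpose (hQ : Qᵀ = Q) (i : ℕ) : (liftQ A Q i)ᵀ = liftQ A Q i := by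
  induction i with
  | zero => simp [liftQ]
  | succ i ih => simp only [liftQ, transpose_add, transpose_mul, transpose_transpose, ih, hQ,
      Matrix.mul_assoc]

lemma costMatrix_posSemidef (hQ : Q.PosSemidef) (hR : R.PosDef) (hP : P.PosSemidef) {i : ℕ}
    (hi : 1 ≤ i) : (costMatrix A B Q R P i).PosSemidef := by
  refine PosSemidef.of_dotProduct_mulVec_nonneg (isHermitian_iff_transpose_eq.2 ?_) fun x => ?_
  · have hM := isHermitian_iff_transpose_eq.1
      (gainWeight_posDef (A := A) (B := B) hQ hR hP hi).isHermitian
    have hPt := isHermitian_iff_transpose_eq.1 hP.isHermitian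
    have hS : ∀ S : Matrix (Fin n) (Fin m) ℝ, ∀ M : Matrix (Fin m) (Fin m) ℝ, Mᵀ = M →
        (S * (M⁻¹ * Sᵀ))ᵀ = S * (M⁻¹ * Sᵀ) := fun S M hM => by
      rw [transpose_mul, transpose_mul, transpose_transpose, transpose_nonsing_inv, hM,
        Matrix.mul_assoc]
    rw [costMatrix, gain, transpose_sub, hS _ _ hM, transpose_add,
      liftQ_transpose (isHermitian_iff_transpose_eq.1 hQ.isHermitian), transpose_mul,
      transpose_mul, transpose_transpose, hPt, Matrix.mul_assoc (A ^ i)ᵀ P (A ^ i)]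
  · rw [star_trivial, costMatrix_eq hQ hR hP hi]
    exact add_nonneg (holdCost_nonneg hQ hR.posSemidef _ _ _) (quadForm_nonneg hP _)

/-- The input that is optimal for `P'` is still a competitor for `P`. -/
lemma costMatrix_mono (hQ : Q.PosSemidef) (hR : R.PosDef) (hP : P.PosSemidef)
    (hP' : P'.PosSemidef) (hle : ∀ x, x ⬝ᵥ (P *ᵥ x) ≤ x ⬝ᵥ (P' *ᵥ x)) {i : ℕ} (hi : 1 ≤ i)
    (x : Fin n → ℝ) :
    x ⬝ᵥ (costMatrix A B Q R P i *ᵥ x) ≤ x ⬝ᵥ (costMatrix A B Q R P' i *ᵥ x) := by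
  rw [costMatrix_eq hQ hR hP' hi]
  exact (costMatrix_le hQ hR hP hi x _).trans (by gcongr; exact hle _)

lemma continuousAt_costMatrix {i : ℕ}
    (hM : (liftR A B Q R i + (liftB A B i)ᵀ * P * liftB A B i).PosDef) :
    ContinuousAt (fun P => costMatrix A B Q R P i) P := by
  have hdet := ((Matrix.isUnit_iff_isUnit_det _).1 hM.isUnit).ne_zero
  have hinv : ContinuousAt
      (fun P => (liftR A B Q R i + (liftB A B i)ᵀ * P * liftB A B i)⁻¹) P := by
    refine ContinuousAt.comp (g := Inv.inv) (continuousAt_matrix_inv _ ?_)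
      (Continuous.continuousAt (by fun_prop))
    simpa only [Ring.inverse_eq_inv'] using continuousAt_inv₀ hdet
  have hc : Continuous fun z : Matrix (Fin n) (Fin n) ℝ × Matrix (Fin m) (Fin m) ℝ =>
      liftQ A Q i + (A ^ i)ᵀ * z.1 * A ^ i - ((A ^ i)ᵀ * z.1 * liftB A B i + liftN A B Q i) *
        (z.2 * ((A ^ i)ᵀ * z.1 * liftB A B i + liftN A B Q i)ᵀ) := by fun_prop
  unfold costMatrix gain
  exact ContinuousAt.comp
    (f := fun P => (P, (liftR A B Q R i + (liftB A B i)ᵀ * P * liftB A B i)⁻¹))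
    hc.continuousAt (continuousAt_id.prodMk hinv)

/-! ### Value iteration -/

lemma iterate_costMatrix_posSemidef (hQ : Q.PosSemidef) (hR : R.PosDef) (hP : P.PosSemidef)
    {i : ℕ} (hi : 1 ≤ i) (k : ℕ) :
    ((fun P => costMatrix A B Q R P i)^[k] P).PosSemidef := by
  induction k with
  | zero => exact hP
  | succ k ih =>
    rw [Function.iterate_succ_apply']
    exact costMatrix_posSemidef hQ hR ih hi

/-- The value iterates are dominated by the cost of any input sequence. -/
lemma iterate_costMatrix_le (hQ : Q.PosSemidef) (hR : R.PosDef) (hP : P.PosSemidef)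
    {i : ℕ} (hi : 1 ≤ i) (k : ℕ) (z : ℕ → Fin n → ℝ) (v : ℕ → Fin m → ℝ)
    (hz : ∀ t, z (t + 1) = holdState A B (z t) (v t) i) :
    z 0 ⬝ᵥ ((fun P => costMatrix A B Q R P i)^[k] P *ᵥ z 0) ≤
      ∑ t ∈ Finset.range k, holdCost A B Q R (z t) (v t) i + z k ⬝ᵥ (P *ᵥ z k) := by
  induction k generalizing z v with
  | zero => simp
  | succ k ih =>
    rw [Function.iterate_succ_apply', Finset.sum_range_succ']
    have h1 := costMatrix_le (A := A) (B := B) hQ hR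
      (iterate_costMatrix_posSemidef (A := A) (B := B) hQ hR hP hi k) hi (z 0) (v 0)
    -- Bellman's principle: the first period is peeled off and the induction hypothesis bounds the
    -- shifted sequence starting at `z 1`.
    have h2 := ih (fun t => z (t + 1)) (fun t => v (t + 1)) (fun t => hz (t + 1))
    rw [← hz 0] at h1
    simp only [zero_add] at h1 h2 ⊢
    linarith

/-- The first iterate dominates `0`, and the monotone operator propagates this. -/
lemma iterate_costMatrix_zero_monotone (hQ : Q.PosSemidef) (hR : R.PosDef) {i : ℕ} (hi : 1 ≤ i)
    (x : Fin n → ℝ) :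
    Monotone fun k => x ⬝ᵥ ((fun P => costMatrix A B Q R P i)^[k] 0 *ᵥ x) := by
  refine monotone_nat_of_le_succ fun k => ?_
  induction k generalizing x with
  | zero =>
    simpa using quadForm_nonneg
      (costMatrix_posSemidef (A := A) (B := B) hQ hR PosSemidef.zero hi) x
  | succ k ih =>
    rw [Function.iterate_succ_apply', Function.iterate_succ_apply' _ (k + 1)]
    exact costMatrix_mono hQ hR (iterate_costMatrix_posSemidef hQ hR PosSemidef.zero hi k)
      (iterate_costMatrix_posSemidef hQ hR PosSemidef.zero hi (k + 1)) ih hi x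

/-! ### Controllability -/

lemma IsControllable.surjective (h : IsControllable A B) (y : Fin n → ℝ) :
    ∃ w : ℕ → Fin m → ℝ, ∑ t ∈ Finset.range n, A ^ t *ᵥ (B *ᵥ w t) = y := by
  have hr := h
  rw [IsControllable, Matrix.rank] at hr
  have htop := Submodule.eq_top_of_finrank_eq
    (hr.trans (by simp : n = Module.finrank ℝ (Fin n → ℝ)))
  obtain ⟨c, hc⟩ := LinearMap.range_eq_top.1 htop y
  refine ⟨fun t b => if ht : t < n then c (⟨t, ht⟩, b) else 0, ?_⟩
  rw [← hc, ← Fin.sum_univ_eq_sum_range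
    (fun t => A ^ t *ᵥ (B *ᵥ fun b => if ht : t < n then c (⟨t, ht⟩, b) else 0))]
  ext r
  simp only [Finset.sum_apply, mulVec_mulVec, mulVecLin_apply]
  simp only [mulVec, dotProduct, Fintype.sum_prod_type, of_apply, Fin.is_lt, dite_true, Fin.eta]

/-- The state of `x ↦ F x + G v t` after `t` steps. -/
def trajectory (F : Matrix (Fin n) (Fin n) ℝ) (G : Matrix (Fin n) (Fin m) ℝ)
    (x : Fin n → ℝ) (v : ℕ → Fin m → ℝ) : ℕ → Fin n → ℝ
  | 0 => x
  | t + 1 => F *ᵥ trajectory F G x v t + G *ᵥ v t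

lemma trajectory_eq (x : Fin n → ℝ) (v : ℕ → Fin m → ℝ) (t : ℕ) :
    trajectory A B x v t =
      A ^ t *ᵥ x + ∑ q ∈ Finset.range t, A ^ q *ᵥ (B *ᵥ v (t - 1 - q)) := by
  induction t with
  | zero => simp [trajectory]
  | succ t ih =>
    rw [trajectory, ih, Finset.sum_range_succ', mulVec_add, mulVec_sum, mulVec_mulVec, pow_succ',
      add_assoc]
    congr 1
    simp only [pow_zero, add_tsub_cancel_right, tsub_zero, mulVec_mulVec, pow_succ',
      Matrix.one_mul]
    congr 1
    refine Finset.sum_congr rfl fun q _ => ?_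
    rw [show t - 1 - q = t - (q + 1) by lia, Matrix.mul_assoc]

/-- Deadbeat control: the first `n` inputs cancel `A ^ n *ᵥ x`, in reversed order because `A ^ q`
acts on the input at time `n - 1 - q`; zero input then keeps the state at the origin. -/
lemma IsControllable.exists_trajectory_eq_zero (h : IsControllable A B) (x : Fin n → ℝ) :
    ∃ v : ℕ → Fin m → ℝ, (∀ t, n ≤ t → v t = 0) ∧ ∀ t, n ≤ t → trajectory A B x v t = 0 := by
  obtain ⟨w, hw⟩ := h.surjective (-(A ^ n *ᵥ x))
  refine ⟨fun t => if t < n then w (n - 1 - t) else 0, fun t ht => if_neg ht.not_gt, ?_⟩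
  intro t ht
  induction t, ht using Nat.le_induction with
  | base =>
    rw [trajectory_eq, ← neg_eq_iff_add_eq_zero, ← hw]
    refine Finset.sum_congr rfl fun q hq => ?_
    have := Finset.mem_range.1 hq
    rw [if_pos (by lia), show n - 1 - (n - 1 - q) = q by lia]
  | succ t ht ih => simp [trajectory, ih, ht.not_gt]

/-! ### The algebraic Riccati equation -/

lemma exists_isRiccatiSolution (hQ : Q.PosSemidef) (hR : R.PosDef) {i : ℕ} (hi : 1 ≤ i)
    (hAB : IsControllable (A ^ i) (liftB A B i)) : ∃ P, IsRiccatiSolution A B Q R i P := by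
  set S : ℕ → Matrix (Fin n) (Fin n) ℝ := fun k => (fun P => costMatrix A B Q R P i)^[k] 0
    with hS
  have hSpsd : ∀ k, (S k).PosSemidef := iterate_costMatrix_posSemidef hQ hR PosSemidef.zero hi
  have hbdd : ∀ x : Fin n → ℝ, ∃ C, ∀ k, x ⬝ᵥ (S k *ᵥ x) ≤ C := by
    intro x
    obtain ⟨v, hv, hz⟩ := hAB.exists_trajectory_eq_zero x
    set z := trajectory (A ^ i) (liftB A B i) x v
    refine ⟨∑ t ∈ Finset.range n, holdCost A B Q R (z t) (v t) i, fun k => ?_⟩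
    -- Passing from `k` to `n + k` periods lets the deadbeat sequence finish; the last `k` periods
    -- cost nothing.
    have h1 := iterate_costMatrix_zero_monotone (A := A) (B := B) hQ hR hi x
      (Nat.le_add_left k n)
    have h2 := iterate_costMatrix_le (A := A) (B := B) hQ hR PosSemidef.zero hi (n + k) z v
      (fun t => rfl)
    rw [Finset.sum_range_add, Finset.sum_eq_zero (s := Finset.range k), zero_mulVec,
      dotProduct_zero, add_zero, add_zero] at h2
    · exact h1.trans h2
    · intro t _
      have hn : n ≤ n + t := Nat.le_add_right n t
      simp [hv _ hn, hz _ hn, holdCost, holdState]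
  have hconv : ∀ x : Fin n → ℝ, ∃ l, Tendsto (fun k => x ⬝ᵥ (S k *ᵥ x)) atTop (𝓝 l) := by
    intro x
    obtain ⟨C, hC⟩ := hbdd x
    exact ⟨_, tendsto_atTop_ciSup (iterate_costMatrix_zero_monotone hQ hR hi x)
      ⟨C, by rintro _ ⟨k, rfl⟩; exact hC k⟩⟩
  choose l hl using hconv
  have hlim : Tendsto S atTop (𝓝 (Matrix.of fun a b =>
      (l (Pi.single a 1 + Pi.single b 1) - l (Pi.single a 1) - l (Pi.single b 1)) / 2)) := by
    refine tendsto_pi_nhds.2 fun a => tendsto_pi_nhds.2 fun b => ?_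
    simp only [of_apply,
      fun k => apply_eq_quadForm (isHermitian_iff_transpose_eq.1 (hSpsd k).isHermitian) a b]
    exact (((hl _).sub (hl _)).sub (hl _)).div_const 2
  set P := Matrix.of fun a b =>
      (l (Pi.single a 1 + Pi.single b 1) - l (Pi.single a 1) - l (Pi.single b 1)) / 2
  have hP : P.PosSemidef := by
    refine PosSemidef.of_dotProduct_mulVec_nonneg (isHermitian_iff_transpose_eq.2 ?_) fun x => ?_
    · refine tendsto_nhds_unique
        ((continuous_id.matrix_transpose.tendsto P).comp hlim) (hlim.congr fun k => ?_)
      exact (isHermitian_iff_transpose_eq.1 (hSpsd k).isHermitian).symm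
    · have hc : Continuous fun M : Matrix (Fin n) (Fin n) ℝ => x ⬝ᵥ (M *ᵥ x) := by fun_prop
      exact ge_of_tendsto' ((hc.tendsto P).comp hlim) fun k => quadForm_nonneg (hSpsd k) x
  refine ⟨P, hP, ?_⟩
  have hstep := (continuousAt_costMatrix
    (gainWeight_posDef (A := A) (B := B) hQ hR hP hi)).tendsto.comp hlim
  refine tendsto_nhds_unique ((tendsto_add_atTop_iff_nat 1).2 hlim) (hstep.congr fun k => ?_)
  simp only [hS, Function.comp_apply, Function.iterate_succ_apply']

/-- Under the feedback of `P`, the cost accumulated over `N` periods is at most `xᵀ P x` and the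
state tends to `0`. The fixed point `P'` is bounded by that cost plus a terminal term, which
vanishes in the limit. -/
lemma IsRiccatiSolution.le (hQ : Q.PosDef) (hR : R.PosDef) {i : ℕ} (hi : 1 ≤ i)
    (hP : IsRiccatiSolution A B Q R i P) (hP' : IsRiccatiSolution A B Q R i P')
    (x : Fin n → ℝ) : x ⬝ᵥ (P' *ᵥ x) ≤ x ⬝ᵥ (P *ᵥ x) := by
  set K := gain A B Q R P i
  set z : ℕ → Fin n → ℝ := fun t => (fun y => holdState A B y (-(K *ᵥ y)) i)^[t] x
  have hz : ∀ t, z (t + 1) = holdState A B (z t) (-(K *ᵥ z t)) i := fun t =>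
    Function.iterate_succ_apply' _ t x
  have hsum : ∀ N, ∑ t ∈ Finset.range N, holdCost A B Q R (z t) (-(K *ᵥ z t)) i +
      z N ⬝ᵥ (P *ᵥ z N) = x ⬝ᵥ (P *ᵥ x) := by
    intro N
    induction N with
    | zero => simp [z]
    | succ N ih =>
      have h1 := costMatrix_eq (A := A) (B := B) hQ.posSemidef hR hP.1 hi (z N)
      rw [← hP.2, ← hz] at h1
      rw [Finset.sum_range_succ, add_assoc, ← h1, ih]
  have hlim : Tendsto z atTop (𝓝 0) := by
    refine tendsto_zero_of_sum_quadForm_le hQ (C := x ⬝ᵥ (P *ᵥ x)) fun N => ?_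
    rw [← hsum N]
    refine le_add_of_le_of_nonneg (Finset.sum_le_sum fun t _ => ?_) (quadForm_nonneg hP.1 _)
    exact quadForm_le_holdCost hQ.posSemidef hR.posSemidef _ _ hi
  have hc : Continuous fun y : Fin n → ℝ => y ⬝ᵥ (P' *ᵥ y) := by fun_prop
  have hbound := ((hc.tendsto 0).comp hlim).const_add (x ⬝ᵥ (P *ᵥ x))
  rw [zero_dotProduct, add_zero] at hbound
  refine ge_of_tendsto' hbound fun N => ?_
  have h2 := iterate_costMatrix_le (A := A) (B := B) hQ.posSemidef hR hP'.1 hi N z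
    (fun t => -(K *ᵥ z t)) hz
  rw [Function.iterate_fixed hP'.2.symm] at h2
  have h3 := hsum N
  have h4 := quadForm_nonneg hP.1 (z N)
  have h5 : z 0 = x := rfl
  rw [h5] at h2
  simp only [Function.comp_apply]
  linarith

lemma existsUnique_isRiccatiSolution (hQ : Q.PosDef) (hR : R.PosDef) {i : ℕ} (hi : 1 ≤ i)
    (hAB : IsControllable (A ^ i) (liftB A B i)) : ∃! P, IsRiccatiSolution A B Q R i P := by
  obtain ⟨P, hP⟩ := exists_isRiccatiSolution hQ.posSemidef hR hi hAB
  exact ⟨P, hP, fun P' hP' => eq_of_quadForm_eq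
    (isHermitian_iff_transpose_eq.1 hP'.1.isHermitian)
    (isHermitian_iff_transpose_eq.1 hP.1.isHermitian)
    fun x => le_antisymm (hP.le hQ hR hi hP' x) (hP'.le hQ hR hi hP x)⟩

/-! ### The closed loop -/

section ClosedLoop

variable {α : ℝ} {I₀ : Finset ℕ} {x : ℕ → Fin n → ℝ} {u : ℕ → Fin m → ℝ} {s I : ℕ → ℕ}

lemma IsClosedLoop.state_eq_holdState (h : IsClosedLoop A B Q R α I₀ P x u s I) (j : ℕ) {q : ℕ}
    (hq : q ≤ I j) :
    x (s j + q) = holdState A B (x (s j)) (-(gain A B Q R P (I j) *ᵥ x (s j))) q := by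
  induction q with
  | zero => rw [holdState_zero, add_zero]
  | succ q ih =>
    rw [holdState_succ, ← ih (by lia), ← add_assoc, h.dynamics,
      h.input j (s j + q) (by lia) (by lia)]

lemma IsClosedLoop.le_sample (hI₀ : ∀ i ∈ I₀, 1 ≤ i)
    (h : IsClosedLoop A B Q R α I₀ P x u s I) (j : ℕ) : j ≤ s j := by
  induction j with
  | zero => exact Nat.zero_le _
  | succ j ih =>
    have := hI₀ _ (h.wait_mem j)
    rw [h.next_sample]
    lia

/-- If the terminal cost never increases by waiting optimally, the closed loop converges. -/
lemma IsClosedLoop.tendsto_zero (hQ : Q.PosDef) (hR : R.PosDef) (hP : P.PosSemidef)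
    (hI₀ : ∀ i ∈ I₀, 1 ≤ i) (h : IsClosedLoop A B Q R α I₀ P x u s I)
    (hle : ∀ j, x (s j) ⬝ᵥ (costMatrix A B Q R P (I j) *ᵥ x (s j)) ≤
      x (s j) ⬝ᵥ (P *ᵥ x (s j))) : Tendsto x atTop (𝓝 0) := by
  have hsum : ∀ j, ∑ k ∈ Finset.range (s j), x k ⬝ᵥ (Q *ᵥ x k) +
      x (s j) ⬝ᵥ (P *ᵥ x (s j)) ≤ x 0 ⬝ᵥ (P *ᵥ x 0) := by
    intro j
    induction j with
    | zero => simp [h.first_sample]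
    | succ j ih =>
      have h1 := hle j
      rw [costMatrix_eq hQ.posSemidef hR hP (hI₀ _ (h.wait_mem j)),
        ← h.state_eq_holdState j le_rfl] at h1
      have h2 := sum_quadForm_holdState_le_holdCost (A := A) (B := B) (Q := Q) hR.posSemidef
        (x (s j)) (-(gain A B Q R P (I j) *ᵥ x (s j))) (I j)
      rw [Finset.sum_congr rfl fun q hq => by
        rw [← h.state_eq_holdState j (Finset.mem_range.1 hq).le]] at h2
      rw [h.next_sample, Finset.sum_range_add]
      linarith
  refine tendsto_zero_of_sum_quadForm_le hQ (C := x 0 ⬝ᵥ (P *ᵥ x 0)) fun N => ?_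
  have h1 : ∑ k ∈ Finset.range N, x k ⬝ᵥ (Q *ᵥ x k) ≤
      ∑ k ∈ Finset.range (s N), x k ⬝ᵥ (Q *ᵥ x k) :=
    Finset.sum_le_sum_of_subset_of_nonneg (Finset.range_mono (h.le_sample hI₀ N))
      fun k _ _ => quadForm_nonneg hQ.posSemidef (x k)
  linarith [hsum N, quadForm_nonneg hP (x (s N))]

end ClosedLoop

/-! ### Resonance -/

lemma exists_arg_eq_of_pow_eq_one {z : ℂ} {k : ℕ} (hk : k ≠ 0) (hz : z ^ k = 1) :
    ∃ r : ℕ, 0 < r ∧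
      (z.arg : Real.Angle) = ((2 * Real.pi / (k : ℝ) * (r : ℝ) : ℝ) : Real.Angle) := by
  have hnorm : ‖z‖ = 1 := Complex.norm_eq_one_of_pow_eq_one hz hk
  have hexp : Complex.exp (k * (z.arg * Complex.I)) = 1 := by
    rw [Complex.exp_nat_mul, ← hz]
    congr 1
    simpa [hnorm] using Complex.norm_mul_exp_arg_mul_I z
  obtain ⟨l, hl⟩ := Complex.exp_eq_one_iff.1 hexp
  have harg : (k : ℝ) * z.arg = l * (2 * Real.pi) := by
    have h1 : ((k : ℂ) * z.arg) * Complex.I = (l * (2 * Real.pi)) * Complex.I := by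
      rw [mul_assoc, hl]; ring
    exact_mod_cast mul_right_cancel₀ Complex.I_ne_zero h1
  have hk' : (k : ℝ) ≠ 0 := Nat.cast_ne_zero.2 hk
  -- The integer `l` may be nonpositive; adding `|l| + 1` full turns makes the multiple of `2π / k`
  -- positive without changing the angle.
  have hpos : 0 < l + k * (|l| + 1) := by
    have h1 : (1 : ℤ) ≤ k := by exact_mod_cast Nat.one_le_iff_ne_zero.2 hk
    have h2 := neg_abs_le l
    nlinarith [abs_nonneg l]
  obtain ⟨r, hr⟩ := Int.eq_ofNat_of_zero_le hpos.le
  refine ⟨r, by lia, Real.Angle.angle_eq_iff_two_pi_dvd_sub.2 ⟨-(|l| + 1), ?_⟩⟩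
  have hr' : (r : ℝ) = l + k * (|l| + 1) := by exact_mod_cast hr.symm
  have harg' : z.arg = l * (2 * Real.pi) / k := by rw [← harg]; field_simp
  rw [hr', harg']
  push_cast
  field_simp
  ring

lemma NoResonance.isGreatest_admissibleRates_eq {I₀ : Finset ℕ} (hI₀ : ∀ i ∈ I₀, 1 ≤ i)
    {γ p : ℕ} (hγ : IsGreatest (I₀ : Set ℕ) γ) (hp : IsGreatest (admissibleRates A I₀) p)
    (h : NoResonance A γ) : p = γ := by
  have hγ0 : γ ≠ 0 := Nat.one_le_iff_ne_zero.1 (hI₀ γ hγ.1)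
  refine le_antisymm (hγ.2 hp.1.1) (hp.2 ⟨hγ.1, fun z hz hz1 hpow => h ?_⟩)
  exact ⟨z, hz, hz1, Complex.norm_eq_one_of_pow_eq_one hpow hγ0,
    exists_arg_eq_of_pow_eq_one hγ0 hpow⟩

end SelfTriggered

open SelfTriggered in
theorem corollary1 {n m : ℕ}
    (A : Matrix (Fin n) (Fin n) ℝ) (B : Matrix (Fin n) (Fin m) ℝ)
    (Q : Matrix (Fin n) (Fin n) ℝ) (R : Matrix (Fin m) (Fin m) ℝ)
    (hQ : Q.PosDef) (hR : R.PosDef) (hAB : IsControllable A B)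
    (α : ℝ) (hα : 0 ≤ α)
    (I₀ : Finset ℕ) (hI₀ : ∀ i ∈ I₀, 1 ≤ i)
    (γ : ℕ) (hγ : IsGreatest (I₀ : Set ℕ) γ)
    (p : ℕ) (hp : IsGreatest (admissibleRates A I₀) p)
    (h : NoResonance A γ ∨ α = 0) :
    (NoResonance A γ → p = γ) ∧
    (IsControllable (A ^ p) (liftB A B p) → ∃! P, IsRiccatiSolution A B Q R p P) ∧
    ∀ P, IsRiccatiSolution A B Q R p P →
      ∀ (x : ℕ → Fin n → ℝ) (u : ℕ → Fin m → ℝ) (s I : ℕ → ℕ),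
        IsClosedLoop A B Q R α I₀ P x u s I →
        Filter.Tendsto x Filter.atTop (nhds 0) := by
  have hp1 : 1 ≤ p := hI₀ p hp.1.1
  refine ⟨NoResonance.isGreatest_admissibleRates_eq hI₀ hγ hp,
    existsUnique_isRiccatiSolution hQ hR hp1, fun P hP x u s I hcl => ?_⟩
  refine hcl.tendsto_zero hQ hR hP.1 hI₀ fun j => ?_
  have hmin := hcl.wait_min j p hp.1.1
  rw [waitCost, waitCost, ← hP.2] at hmin
  have hα' : α / (p : ℝ) ≤ α / (I j : ℝ) := by
    rcases h with h | rfl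
    · have hpγ : p = γ := h.isGreatest_admissibleRates_eq hI₀ hγ hp
      have hI1 : (0 : ℝ) < I j := by exact_mod_cast hI₀ _ (hcl.wait_mem j)
      have hIp : I j ≤ p := hpγ ▸ hγ.2 (hcl.wait_mem j)
      gcongr
    · simp
  linarith
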